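/- Let $\mathcal{X} = [0,1]\cup\{\star\}$, $\mathcal{Y}=\{0,1\}$, and let $\mathcal{H} = \{x \mapsto \mathbb{1}\{x \le a\}\,\mathbb{1}\{x \ne \star\} : a \in [0,1]\}$ be the class of thresholds. Fix integers $T \ge 1$ and $n \ge 0$ such that $n+1$ divides $T$ and $\frac{T}{n+1}+1 = 2^k$ for some $k \in \mathbb{N}$. A (deterministic) Predictor $\mathcal{P}$ maps every initial segment $x_{1:t}$ ($0 \le t \le T$) of a stream of examples to a prediction $\mathcal{P}(x_{1:t}) \in \mathcal{X}^T$ of the whole stream. It is consistent if $\mathcal{P}(x_{1:t})_s = x_s$ for all $x_{1:T}\in\mathcal{X}^T$ and $1\le s \le t \le T$, and lazy if, for all $x_{1:T}\in\mathcal{X}^T$ and $1 \le t \le T$, $\mathcal{P}(x_{1:t-1})_t = x_t$ implies $\mathcal{P}(x_{1:t}) = \mathcal{P}(x_{1:t-1})$. Its number of mistakes on $x_{1:T}$ is $\operatorname{M}_{\mathcal{P}}(x_{1:T}) = \sum_{t=2}^T \mathbb{1}\{\mathcal{P}(x_{1:t-1})_t \neq x_t\}$. A (randomized) online learner using $\mathcal{P}$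 outputs in each round $t=1,\dots,T$ a random label $\hat y_t \in \{0,1\}$, based on $(x_1,y_1),\dots,(x_{t-1},y_{t-1})$, the current example $x_t$, the predictions $\mathcal{P}(x_{1:1}),\dots,\mathcal{P}(x_{1:t})$ revealed so far, and its internal randomness; the true label $y_t$ is then revealed. A stream $(x_1,y_1),\dots,(x_T,y_T)$ is realizable if there is $h\in\mathcal{H}$ with $h(x_t)=y_t$ for all $t$. Then there exists a deterministic, lazy, consistent Predictor $\mathcal{P}$ such that for every online learner using $\mathcal{P}$ there exists a realizable stream $(x_1,y_1),\dots,(x_T,y_T)$ with $\operatorname{M}_{\mathcal{P}}(x_{1:T}) = n$ and $$\mathbb{E}\left[\sum_{t=1}^T \mathbb{1}\{\hat y_t \ne y_t\}\right] \ \ge\ \frac{n+1}{2}\,\log_2\!\left(\frac{T}{n+1}\right).$$ -/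

import Mathlib

open MeasureTheory

/-- A deterministic Predictor for streams of length `T`: having seen the examples `x_1, …, x_t`
(as a list), it outputs a prediction of the entire stream of `T` examples. -/
abbrev Predictor (X : Type*) (T : ℕ) := List X → (Fin T → X)

/-- The first `t` entries of the stream `x` of length `T`, as a list (rounds are 0-indexed,
so these are the entries with index `0, …, t - 1`). -/
def prefixOf {Z : Type*} {T : ℕ} (x : Fin T → Z) (t : ℕ) : List Z := (List.ofFn x).take t

namespace Predictor

variable {X : Type*} {T : ℕ}

/-- The prediction made after seeing `t` examples of `x` agrees with `x` on these examples. -/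
def IsConsistent (P : Predictor X T) : Prop :=
  ∀ (x : Fin T → X) (t : ℕ), t ≤ T → ∀ s : Fin T, (s : ℕ) < t → P (prefixOf x t) s = x s

/-- The Predictor keeps its prediction as long as the next example was predicted correctly. -/
def IsLazy (P : Predictor X T) : Prop :=
  ∀ (x : Fin T → X) (t : Fin T),
    P (prefixOf x t) t = x t → P (prefixOf x (t + 1)) = P (prefixOf x t)

open scoped Classical in
/-- The number of mistakes of `P` on the stream `x`: the number of rounds, the first one
excluded, whose example was predicted incorrectly just before it was revealed. -/
noncomputable def mistakes (P : Predictor X T) (x : Fin T → X) : ℕ :=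
  (Finset.univ.filter fun t : Fin T => 1 ≤ (t : ℕ) ∧ P (prefixOf x t) t ≠ x t).card

end Predictor

/-- A randomized online learner for binary labels that has access to a Predictor. All its
randomness is a seed in `Ω`. In a round, `predict ω history x preds` is its predicted label, where
`history` is the list of labelled examples of the previous rounds, `x` is the current example, and
`preds` is the list of the Predictor's outputs in all rounds up to and including the current one
(so a learner may remember earlier predictions; one that reads only the latest is a special
case). -/
structure OnlineLearner (Ω : Type*) [MeasurableSpace Ω] (X : Type*) (T : ℕ) where
  predict : Ω → List (X × Bool) → X → List (Fin T → X) → Bool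
  measurable_predict : ∀ (history : List (X × Bool)) (x : X) (preds : List (Fin T → X)),
    Measurable fun ω => predict ω history x preds

namespace OnlineLearner

variable {Ω : Type*} [MeasurableSpace Ω] {X : Type*} {T : ℕ}

/-- The label that the learner with seed `ω` predicts in round `t`, when it interacts with the
Predictor `P` on the labelled stream `(x, y)`. -/
def play (A : OnlineLearner Ω X T) (P : Predictor X T) (x : Fin T → X) (y : Fin T → Bool)
    (ω : Ω) (t : Fin T) : Bool :=
  A.predict ω (prefixOf (fun s => (x s, y s)) t) (x t)
    ((List.range (t + 1)).map fun s => P (prefixOf x (s + 1)))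

/-- The expected number of mistakes of the learner on the labelled stream `(x, y)`, when it uses
the Predictor `P` and its seed has law `μ`. -/
noncomputable def expectedMistakes (μ : Measure Ω) (A : OnlineLearner Ω X T) (P : Predictor X T)
    (x : Fin T → X) (y : Fin T → Bool) : ℝ :=
  ∫ ω, ∑ t : Fin T, (if A.play P x y ω t ≠ y t then (1 : ℝ) else 0) ∂μ

end OnlineLearner

/-- The example space `[0,1] ∪ {⋆}`, where `⋆` is `none`. -/
abbrev ThresholdDomain := Option (Set.Icc (0 : ℝ) 1)

open scoped Classical in
/-- The hypothesis `x ↦ 1{x ≤ a} 1{x ≠ ⋆}`. -/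
noncomputable def threshold (a : Set.Icc (0 : ℝ) 1) : ThresholdDomain → Bool
  | none => false
  | some x => decide (x ≤ a)

/-- The class of thresholds on `[0,1] ∪ {⋆}`. -/
def thresholdClass : Set (ThresholdDomain → Bool) := Set.range threshold

/-- A labelled stream is realizable by `H` if some hypothesis in `H` gives all its labels. -/
def Realizable {X : Type*} {T : ℕ} (H : Set (X → Bool)) (x : Fin T → X) (y : Fin T → Bool) : Prop :=
  ∃ h ∈ H, ∀ t, h (x t) = y t

/-!
The stream consists of `n + 1` blocks of `2 ^ k - 1` rounds. Every block runs through the midpoints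
of the top `k` levels of the dyadic tree below one dyadic interval, level by level and from left to
right. The intervals are nested: a bit sequence `β` picks a path through the dyadic tree, the
threshold lies at the end of this path, and the interval of a block is the one that the path has
reached when the block starts. So the stream visits all `(n + 1) * k` midpoints on the path, in
order. All labels seen before the visit of the `d`-th of them (`pathTime`) are determined by the
bits `β i`, `i < d` (`label_congr`), whereas its own label is `β d` (`label_pathTime`). Hence the
prediction of the learner there has a law that does not depend on `β d`, and choosing the bits one
after the other (`exists_bits`) makes the learner err with probability at least `1 / 2` at each of
these midpoints. This gives `(n + 1) * k / 2 ≥ (n + 1) / 2 * log₂ (2 ^ k - 1)` expected mistakes.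

The Predictor does not see labels, but the first example of a block is the midpoint of the
interval of the block and thus reveals all of the block. So the Predictor that, after a mistake,
completes the current block accordingly and predicts `⋆` from then on, errs only at the starts
of blocks, which are `n` in number if the first is left out.
-/

/-! ### Predictors that revise their prediction after a mistake -/

/-- One round of a Predictor that keeps a prediction of the stream (extended to all of `ℕ`)
together with the number of examples seen. If the new example `a` of round `t` was predicted
incorrectly, the predictions for later rounds are replaced by `guess t a`. -/
noncomputable def reviseStep {X : Type*} (guess : ℕ → X → ℕ → X) (p : (ℕ → X) × ℕ) (a : X) :
    (ℕ → X) × ℕ :=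
  open scoped Classical in
  if p.1 p.2 = a then (p.1, p.2 + 1)
  else (fun s => if s < p.2 then p.1 s else if s = p.2 then a else guess p.2 a s, p.2 + 1)

/-- The Predictor that starts with the prediction `p₀` and changes it by `reviseStep`. -/
noncomputable def revisingPredictor {X : Type*} (T : ℕ) (p₀ : ℕ → X) (guess : ℕ → X → ℕ → X) :
    Predictor X T :=
  fun l s => (l.foldl (reviseStep guess) (p₀, 0)).1 s

theorem prefixOf_zero {Z : Type*} {T : ℕ} (x : Fin T → Z) : prefixOf x 0 = [] := by
  simp [prefixOf]

theorem prefixOf_succ {Z : Type*} {T : ℕ} (x : Fin T → Z) (t : Fin T) :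
    prefixOf x (t + 1) = prefixOf x t ++ [x t] := by
  simp [prefixOf, List.take_add_one]

theorem prefixOf_congr {Z : Type*} {T : ℕ} {x x' : Fin T → Z} {t : ℕ}
    (h : ∀ s : Fin T, (s : ℕ) < t → x s = x' s) : prefixOf x t = prefixOf x' t := by
  apply List.ext_getElem
  · simp [prefixOf]
  · intro i h₁ h₂
    simp only [prefixOf, List.length_take, List.length_ofFn, lt_min_iff] at h₁
    simpa [prefixOf] using h ⟨i, h₁.2⟩ h₁.1

section revisingPredictor

variable {X : Type*} {T : ℕ} (p₀ : ℕ → X) (guess : ℕ → X → ℕ → X)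

theorem foldl_reviseStep_succ (x : Fin T → X) (t : Fin T) :
    (prefixOf x (t + 1)).foldl (reviseStep guess) (p₀, 0) =
      reviseStep guess ((prefixOf x t).foldl (reviseStep guess) (p₀, 0)) (x t) := by
  rw [prefixOf_succ, List.foldl_append, List.foldl_cons, List.foldl_nil]

theorem foldl_reviseStep_snd (x : Fin T → X) (t : ℕ) (ht : t ≤ T) :
    ((prefixOf x t).foldl (reviseStep guess) (p₀, 0)).2 = t := by
  induction t with
  | zero => simp [prefixOf_zero]
  | succ t ih =>
    have h := foldl_reviseStep_succ p₀ guess x ⟨t, ht⟩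
    simp only at h
    rw [h, reviseStep]
    split_ifs <;> simp [ih (by omega)]

theorem foldl_reviseStep_of_eq (x : Fin T → X) (t : Fin T)
    (h : ((prefixOf x t).foldl (reviseStep guess) (p₀, 0)).1 t = x t) :
    ((prefixOf x (t + 1)).foldl (reviseStep guess) (p₀, 0)).1 =
      ((prefixOf x t).foldl (reviseStep guess) (p₀, 0)).1 := by
  rw [foldl_reviseStep_succ, reviseStep, foldl_reviseStep_snd _ _ _ _ t.2.le, if_pos h]

theorem foldl_reviseStep_of_ne (x : Fin T → X) (t : Fin T)
    (h : ((prefixOf x t).foldl (reviseStep guess) (p₀, 0)).1 t ≠ x t) (s : ℕ) :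
    ((prefixOf x (t + 1)).foldl (reviseStep guess) (p₀, 0)).1 s =
      if s < t then ((prefixOf x t).foldl (reviseStep guess) (p₀, 0)).1 s
      else if s = t then x t else guess t (x t) s := by
  rw [foldl_reviseStep_succ, reviseStep, foldl_reviseStep_snd _ _ _ _ t.2.le, if_neg h]

theorem revisingPredictor_isLazy : (revisingPredictor T p₀ guess).IsLazy := by
  intro x t h
  funext s
  exact congrFun (foldl_reviseStep_of_eq p₀ guess x t h) s

theorem revisingPredictor_isConsistent : (revisingPredictor T p₀ guess).IsConsistent := by
  intro x t
  induction t with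
  | zero => intro _ s hs; omega
  | succ t ih =>
    intro ht s hs
    have ih := ih (by omega) s
    simp only [revisingPredictor] at ih
    change ((prefixOf x ((⟨t, ht⟩ : Fin T) + 1)).foldl (reviseStep guess) (p₀, 0)).1 s = x s
    by_cases h : ((prefixOf x t).foldl (reviseStep guess) (p₀, 0)).1 t = x ⟨t, ht⟩
    · rw [foldl_reviseStep_of_eq _ _ _ _ h]
      rcases Nat.lt_succ_iff_lt_or_eq.mp hs with hs | hs
      · exact ih hs
      · have : s = ⟨t, ht⟩ := Fin.ext hs
        subst this
        exact h
    · rw [foldl_reviseStep_of_ne _ _ _ _ h]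
      rcases Nat.lt_succ_iff_lt_or_eq.mp hs with hs | hs
      · rw [if_pos hs, ih hs]
      · have : s = ⟨t, ht⟩ := Fin.ext hs
        subst this
        simp

end revisingPredictor

/-! ### Paths in the dyadic tree -/

/-- The number with binary digits `β 0, …, β (d - 1)`, the most significant first: the horizontal
position of the node of depth `d` on the path `β` through the binary tree. -/
def addr (β : ℕ → Bool) : ℕ → ℕ
  | 0 => 0
  | d + 1 => 2 * addr β d + (β d).toNat

theorem addr_lt (β : ℕ → Bool) (d : ℕ) : addr β d < 2 ^ d := by
  induction d with
  | zero => simp [addr]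
  | succ d ih =>
    have := Bool.toNat_le (β d)
    rw [addr, pow_succ]
    omega

theorem addr_congr {β γ : ℕ → Bool} {d : ℕ} (h : ∀ i < d, β i = γ i) : addr β d = addr γ d := by
  induction d with
  | zero => rfl
  | succ d ih => rw [addr, addr, ih fun i hi => h i (by omega), h d (by omega)]

theorem addr_add_div (β : ℕ → Bool) (d e : ℕ) : addr β (d + e) / 2 ^ e = addr β d := by
  induction e with
  | zero => simp
  | succ e ih =>
    have := Bool.toNat_le (β (d + e))
    rw [pow_succ', ← Nat.div_div_eq_div_mul, ← add_assoc, addr]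
    rw [show (2 * addr β (d + e) + (β (d + e)).toNat) / 2 = addr β (d + e) by omega, ih]

/-- The midpoint `(q + 1/2) / 2 ^ d` of the `q`-th dyadic interval of length `2 ^ (-d)`. The
projection to `[0,1]` does nothing if `q < 2 ^ d`. -/
noncomputable def midpoint01 (d q : ℕ) : Set.Icc (0 : ℝ) 1 :=
  Set.projIcc 0 1 zero_le_one ((2 * q + 1) / 2 ^ (d + 1))

theorem coe_midpoint01 {d q : ℕ} (h : q < 2 ^ d) :
    (midpoint01 d q : ℝ) = (2 * q + 1) / 2 ^ (d + 1) := by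
  have h' : (2 * q + 1 : ℝ) ≤ 2 ^ (d + 1) := by
    have : 2 * q + 1 ≤ 2 ^ (d + 1) := by rw [pow_succ]; omega
    exact_mod_cast this
  rw [midpoint01, Set.projIcc_of_mem zero_le_one ⟨by positivity, (div_le_one (by positivity)).2 h'⟩]

/-- The left end of the dyadic interval of length `2 ^ (-N)` at which the path `β` arrives. -/
noncomputable def pathEnd (β : ℕ → Bool) (N : ℕ) : Set.Icc (0 : ℝ) 1 :=
  ⟨addr β N / 2 ^ N, by positivity,
    (div_le_one (by positivity)).2 (by exact_mod_cast (addr_lt β N).le)⟩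

theorem coe_pathEnd (β : ℕ → Bool) (N : ℕ) : (pathEnd β N : ℝ) = addr β N / 2 ^ N := rfl

theorem midpoint01_le_pathEnd_iff (β : ℕ → Bool) {N d q : ℕ} (hd : d < N) (hq : q < 2 ^ d) :
    midpoint01 d q ≤ pathEnd β N ↔ 2 * q + 1 ≤ addr β (d + 1) := by
  obtain ⟨e, rfl⟩ := Nat.exists_eq_add_of_le (Nat.succ_le_of_lt hd)
  rw [← addr_add_div β (d + 1) e, Nat.le_div_iff_mul_le (by positivity), ← Subtype.coe_le_coe,
    coe_midpoint01 hq, coe_pathEnd, Nat.succ_eq_add_one, pow_add (2 : ℝ) (d + 1) e,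
    div_le_div_iff₀ (by positivity) (by positivity), mul_comm ((2 : ℝ) ^ (d + 1)), ← mul_assoc,
    mul_le_mul_iff_left₀ (by positivity)]
  exact_mod_cast Iff.rfl

/-! ### The stream of a path -/

/-- The depth in the dyadic tree of the midpoint that is presented in round `t`. In a block, the
round with offset `i` presents the node that has number `i + 1` in the heap order of a binary
tree, where the nodes of depth `j` are numbered by `2 ^ j, …, 2 ^ (j + 1) - 1`. -/
def depth (k t : ℕ) : ℕ := t / (2 ^ k - 1) * k + Nat.log 2 (t % (2 ^ k - 1) + 1)

/-- The horizontal position in the dyadic tree of the midpoint that is presented in round `t`, if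
the root of the block has position `u`. -/
def position (k u t : ℕ) : ℕ :=
  u * 2 ^ Nat.log 2 (t % (2 ^ k - 1) + 1) +
    (t % (2 ^ k - 1) + 1 - 2 ^ Nat.log 2 (t % (2 ^ k - 1) + 1))

/-- The position of the node presented in round `t` on the stream of the path `β`: the root of
the block of round `t` is the node of the path at depth `t / (2 ^ k - 1) * k`. -/
def pathPosition (k : ℕ) (β : ℕ → Bool) (t : ℕ) : ℕ :=
  position k (addr β (t / (2 ^ k - 1) * k)) t

/-- The example of round `t` in the stream of the path `β`. -/
noncomputable def stream (k : ℕ) (β : ℕ → Bool) (t : ℕ) : ThresholdDomain :=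
  some (midpoint01 (depth k t) (pathPosition k β t))

/-- The label of round `t` in the stream of the path `β`: whether the path passes to the right of
the presented midpoint. -/
def label (k : ℕ) (β : ℕ → Bool) (t : ℕ) : Bool :=
  decide (2 * pathPosition k β t + 1 ≤ addr β (depth k t + 1))

/-- The round in which the node of depth `d` on the path `β` is presented. -/
def pathTime (k : ℕ) (β : ℕ → Bool) (d : ℕ) : ℕ :=
  (2 ^ k - 1) * (d / k) + (2 ^ (d % k) - 1 + addr β d % 2 ^ (d % k))

theorem log_mod_lt {k : ℕ} (hk : 0 < k) (t : ℕ) : Nat.log 2 (t % (2 ^ k - 1) + 1) < k := by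
  have h1 : 1 < 2 ^ k := Nat.one_lt_two_pow hk.ne'
  have := Nat.mod_lt t (show 0 < 2 ^ k - 1 by omega)
  exact Nat.log_lt_of_lt_pow (by omega) (by omega)

theorem pathPosition_lt (k : ℕ) (β : ℕ → Bool) (t : ℕ) :
    pathPosition k β t < 2 ^ depth k t := by
  have h1 := Nat.lt_pow_succ_log_self one_lt_two (t % (2 ^ k - 1) + 1)
  have h2 : 2 ^ Nat.log 2 (t % (2 ^ k - 1) + 1) ≤ t % (2 ^ k - 1) + 1 :=
    Nat.pow_log_le_self 2 (by omega)
  have h3 := Nat.mul_le_mul_right (2 ^ Nat.log 2 (t % (2 ^ k - 1) + 1))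
    (Nat.succ_le_of_lt (addr_lt β (t / (2 ^ k - 1) * k)))
  rw [pathPosition, position, depth, pow_add]
  rw [pow_succ] at h1
  rw [Nat.succ_mul] at h3
  omega

theorem depth_lt {k n t : ℕ} (hk : 0 < k) (ht : t < (n + 1) * (2 ^ k - 1)) :
    depth k t < (n + 1) * k := by
  have h1 := log_mod_lt hk t
  have h2 := Nat.mul_le_mul_right k
    (Nat.succ_le_of_lt (Nat.div_lt_of_lt_mul (by rwa [mul_comm] at ht)))
  rw [Nat.succ_mul] at h2
  rw [depth]
  omega

theorem threshold_stream (k : ℕ) (β : ℕ → Bool) {N t : ℕ} (h : depth k t < N) :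
    threshold (pathEnd β N) (stream k β t) = label k β t := by
  simp only [threshold, stream, label]
  exact decide_eq_decide.2 (midpoint01_le_pathEnd_iff β h (pathPosition_lt k β t))

theorem pathTime_offset_lt {k : ℕ} (hk : 0 < k) (β : ℕ → Bool) (d : ℕ) :
    2 ^ (d % k) - 1 + addr β d % 2 ^ (d % k) < 2 ^ k - 1 := by
  have h1 := Nat.mod_lt (addr β d) (show 0 < 2 ^ (d % k) by positivity)
  have h2 : 2 ^ (d % k + 1) ≤ 2 ^ k := Nat.pow_le_pow_right two_pos (Nat.mod_lt d hk)
  have h3 : 0 < 2 ^ (d % k) := by positivity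
  rw [pow_succ] at h2
  omega

theorem pathTime_div {k : ℕ} (hk : 0 < k) (β : ℕ → Bool) (d : ℕ) :
    pathTime k β d / (2 ^ k - 1) = d / k := by
  have h := pathTime_offset_lt hk β d
  rw [pathTime, Nat.mul_add_div (by omega), Nat.div_eq_of_lt h, add_zero]

theorem pathTime_mod {k : ℕ} (hk : 0 < k) (β : ℕ → Bool) (d : ℕ) :
    pathTime k β d % (2 ^ k - 1) = 2 ^ (d % k) - 1 + addr β d % 2 ^ (d % k) := by
  rw [pathTime, Nat.mul_add_mod, Nat.mod_eq_of_lt (pathTime_offset_lt hk β d)]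

theorem log_pathTime_mod {k : ℕ} (hk : 0 < k) (β : ℕ → Bool) (d : ℕ) :
    Nat.log 2 (pathTime k β d % (2 ^ k - 1) + 1) = d % k := by
  have h1 := Nat.mod_lt (addr β d) (show 0 < 2 ^ (d % k) by positivity)
  have h3 : 0 < 2 ^ (d % k) := by positivity
  rw [pathTime_mod hk, Nat.log_eq_iff (Or.inr ⟨one_lt_two, by omega⟩), pow_succ]
  omega

theorem pathTime_lt {k n d : ℕ} (hk : 0 < k) (β : ℕ → Bool) (hd : d < (n + 1) * k) :
    pathTime k β d < (n + 1) * (2 ^ k - 1) := by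
  have h := pathTime_offset_lt hk β d
  rw [← Nat.div_lt_iff_lt_mul (by omega), pathTime_div hk, Nat.div_lt_iff_lt_mul hk]
  exact hd

theorem depth_pathTime {k : ℕ} (hk : 0 < k) (β : ℕ → Bool) (d : ℕ) :
    depth k (pathTime k β d) = d := by
  rw [depth, log_pathTime_mod hk, pathTime_div hk, Nat.div_add_mod']

theorem pathPosition_pathTime {k : ℕ} (hk : 0 < k) (β : ℕ → Bool) (d : ℕ) :
    pathPosition k β (pathTime k β d) = addr β d := by
  have h1 := Nat.mod_lt (addr β d) (show 0 < 2 ^ (d % k) by positivity)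
  have h2 := addr_add_div β (d / k * k) (d % k)
  have h3 := Nat.div_add_mod' (addr β d) (2 ^ (d % k))
  have h4 : 0 < 2 ^ (d % k) := by positivity
  rw [Nat.div_add_mod'] at h2
  rw [h2] at h3
  rw [pathPosition, position, log_pathTime_mod hk, pathTime_mod hk, pathTime_div hk]
  omega

theorem label_pathTime {k : ℕ} (hk : 0 < k) (β : ℕ → Bool) (d : ℕ) :
    label k β (pathTime k β d) = β d := by
  rw [label, pathPosition_pathTime hk, depth_pathTime hk, addr]
  cases β d <;> simp

theorem depth_le_of_le_pathTime {k : ℕ} (hk : 0 < k) {β : ℕ → Bool} {d t : ℕ}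
    (h : t ≤ pathTime k β d) : depth k t ≤ d := by
  have h1 := Nat.div_le_div_right (c := 2 ^ k - 1) h
  have h2 := log_mod_lt hk t
  have h3 := Nat.div_add_mod' d k
  rw [pathTime_div hk] at h1
  rcases h1.lt_or_eq with h1 | h1
  · have := Nat.mul_le_mul_right k (Nat.succ_le_of_lt h1)
    rw [Nat.succ_mul] at this
    rw [depth]
    omega
  · have h4 := Nat.div_add_mod' t (2 ^ k - 1)
    have h5 := Nat.div_add_mod' (pathTime k β d) (2 ^ k - 1)
    rw [pathTime_div hk] at h5
    rw [h1] at h4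
    have h6 : Nat.log 2 (t % (2 ^ k - 1) + 1) ≤ d % k := by
      rw [← log_pathTime_mod hk β d]
      exact Nat.log_mono_right (by omega)
    rw [depth, h1]
    omega

/-- Within a level of the tree, the nodes to the left of the path are presented before the node
on the path. -/
theorem pathPosition_lt_addr {k : ℕ} (hk : 0 < k) {β : ℕ → Bool} {d t : ℕ}
    (h : t < pathTime k β d) (hd : depth k t = d) : pathPosition k β t < addr β d := by
  have h1 : t / (2 ^ k - 1) = d / k := by
    have h2 := log_mod_lt hk t
    rw [← hd, depth, mul_comm, Nat.mul_add_div hk, Nat.div_eq_of_lt h2, add_zero]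
  have h2 : Nat.log 2 (t % (2 ^ k - 1) + 1) = d % k := by
    have h3 := Nat.div_add_mod' d k
    rw [depth, h1] at hd
    omega
  have h4 := Nat.div_add_mod' t (2 ^ k - 1)
  have h5 := Nat.div_add_mod' (pathTime k β d) (2 ^ k - 1)
  rw [pathTime_div hk] at h5
  rw [h1] at h4
  have h6 : 2 ^ (d % k) ≤ t % (2 ^ k - 1) + 1 := by
    rw [← h2]
    exact Nat.pow_log_le_self 2 (by omega)
  rw [← pathPosition_pathTime hk β d, pathPosition, pathPosition, position, position, h1, h2,
    log_pathTime_mod hk, pathTime_div hk]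
  omega

theorem pathTime_congr (k : ℕ) {β γ : ℕ → Bool} {d : ℕ} (h : ∀ i < d, β i = γ i) :
    pathTime k β d = pathTime k γ d := by
  rw [pathTime, pathTime, addr_congr h]

theorem pathPosition_congr {k : ℕ} {β γ : ℕ → Bool} {d t : ℕ} (h : ∀ i < d, β i = γ i)
    (ht : depth k t ≤ d) : pathPosition k β t = pathPosition k γ t := by
  rw [depth] at ht
  rw [pathPosition, pathPosition, addr_congr fun i hi => h i (by omega)]

theorem stream_congr {k : ℕ} (hk : 0 < k) {β γ : ℕ → Bool} {d t : ℕ} (h : ∀ i < d, β i = γ i)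
    (ht : t ≤ pathTime k β d) : stream k β t = stream k γ t := by
  rw [stream, stream, pathPosition_congr h (depth_le_of_le_pathTime hk ht)]

theorem label_congr {k : ℕ} (hk : 0 < k) {β γ : ℕ → Bool} {d t : ℕ} (h : ∀ i < d, β i = γ i)
    (ht : t < pathTime k β d) : label k β t = label k γ t := by
  rcases (depth_le_of_le_pathTime hk ht.le).lt_or_eq with hd | hd
  · rw [label, label, pathPosition_congr h hd.le, addr_congr fun i hi => h i (by omega)]
  · -- such a node lies to the left of the path, so its label is `true` in both streams
    have h1 := pathPosition_lt_addr hk ht hd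
    have h2 : pathPosition k γ t < addr γ d := by
      rwa [← pathPosition_congr h hd.le, ← addr_congr h]
    rw [label, label, hd, addr, addr, decide_eq_true (by omega), decide_eq_true (by omega)]

/-! ### The Predictor and its mistakes -/

/-- The completion of a block, given that the example `a` was seen in its first round `t`. If `a`
is the midpoint of an interval of length `2 ^ (-d)`, with `d = t / (2 ^ k - 1) * k`, then
`⌊a * 2 ^ d⌋` is the position of this interval. All rounds after the block are predicted to be `⋆`, which makes
the start of the next block a mistake. -/
noncomputable def blockGuess (k t : ℕ) (a : ThresholdDomain) (s : ℕ) : ThresholdDomain :=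
  if s / (2 ^ k - 1) = t / (2 ^ k - 1) then
    some (midpoint01 (depth k s)
      (position k ⌊a.elim 0 (fun v => (v : ℝ)) * 2 ^ (t / (2 ^ k - 1) * k)⌋₊ s))
  else none

theorem blockGuess_stream {k t s : ℕ} (β : ℕ → Bool) (ht : 2 ^ k - 1 ∣ t)
    (hs : s / (2 ^ k - 1) = t / (2 ^ k - 1)) :
    blockGuess k t (stream k β t) s = stream k β s := by
  have h0 : t % (2 ^ k - 1) = 0 := Nat.mod_eq_zero_of_dvd ht
  have hd : depth k t = t / (2 ^ k - 1) * k := by simp [depth, h0]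
  have hp : pathPosition k β t = addr β (t / (2 ^ k - 1) * k) := by
    simp [pathPosition, position, h0]
  have hfloor : ⌊(stream k β t).elim 0 (fun v => (v : ℝ)) * 2 ^ (t / (2 ^ k - 1) * k)⌋₊ =
      addr β (t / (2 ^ k - 1) * k) := by
    rw [stream, Option.elim_some, coe_midpoint01 (pathPosition_lt k β t), hp, hd, Nat.floor_eq_iff
      (by positivity), pow_succ]
    generalize t / (2 ^ k - 1) * k = d
    have : (2 * (addr β d : ℝ) + 1) / (2 ^ d * 2) * 2 ^ d = addr β d + 1 / 2 := by
      field_simp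
    rw [this]
    constructor <;> linarith
  rw [blockGuess, if_pos hs, hfloor, stream, pathPosition, hs]

/-- The Predictor that predicts `⋆` until a mistake, and then completes the current block. -/
noncomputable def blockPredictor (k T : ℕ) : Predictor ThresholdDomain T :=
  revisingPredictor T (fun _ => none) (blockGuess k)

/-- On the stream of a path, the prediction is correct for the current block, and `⋆` for later
blocks. -/
theorem blockPredictor_stream (k : ℕ) {T : ℕ} (β : ℕ → Bool) (t : ℕ) (ht : t ≤ T) (s : Fin T) :
    blockPredictor k T (prefixOf (fun i : Fin T => stream k β i) t) s =
      if (s : ℕ) < t ∨ 0 < t ∧ (s : ℕ) / (2 ^ k - 1) = (t - 1) / (2 ^ k - 1) then stream k β s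
      else none := by
  induction t generalizing s with
  | zero => simp [prefixOf_zero, blockPredictor, revisingPredictor]
  | succ t ih =>
    have ih := ih (by omega)
    set x : Fin T → ThresholdDomain := fun i => stream k β i with hx
    have iht := ih ⟨t, ht⟩
    have ihs := ih s
    simp only [blockPredictor, revisingPredictor] at iht ihs
    change ((prefixOf x ((⟨t, ht⟩ : Fin T) + 1)).foldl (reviseStep (blockGuess k)) _).1 s = _
    by_cases h : 0 < t ∧ t / (2 ^ k - 1) = (t - 1) / (2 ^ k - 1)
    · rw [if_pos (Or.inr h)] at iht
      rw [foldl_reviseStep_of_eq _ _ _ _ iht, ihs]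
      refine if_congr ?_ rfl rfl
      rw [Nat.add_sub_cancel, h.2]
      rcases lt_trichotomy (s : ℕ) t with h1 | h1 | h1
      · simp [h1, h1.trans (Nat.lt_succ_self t)]
      · simp [h1, h]
      · simp [h.1]
        omega
    · rw [if_neg (by simpa using h)] at iht
      have hdvd : 2 ^ k - 1 ∣ t := by
        rcases Nat.eq_zero_or_pos t with h0 | h0
        · simp [h0]
        · by_contra hd
          refine h ⟨h0, ?_⟩
          obtain ⟨t, rfl⟩ := Nat.exists_eq_add_of_le' h0
          rw [Nat.succ_div_of_not_dvd hd, Nat.add_sub_cancel]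
      rw [foldl_reviseStep_of_ne _ _ _ _ (by rw [iht]; simp [hx, stream])]
      simp only [Nat.add_sub_cancel, Nat.zero_lt_succ, true_and]
      rcases lt_trichotomy (s : ℕ) t with h1 | h1 | h1
      · rw [if_pos h1, if_pos (Or.inl (by omega)), ihs, if_pos (Or.inl h1)]
      · rw [if_neg (by omega), if_pos h1, if_pos (Or.inl (by omega)), hx, h1]
      · rw [if_neg (by omega), if_neg (by omega)]
        by_cases h2 : (s : ℕ) / (2 ^ k - 1) = t / (2 ^ k - 1)
        · rw [if_pos (Or.inr h2)]
          exact blockGuess_stream β hdvd h2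
        · rw [if_neg (by omega), blockGuess, if_neg h2]

theorem Predictor.mistakes_eq_ncard {X : Type*} {T : ℕ} (P : Predictor X T) (x : Fin T → X) :
    P.mistakes x = {t : Fin T | 1 ≤ (t : ℕ) ∧ P (prefixOf x t) t ≠ x t}.ncard := by
  rw [Predictor.mistakes, ← Set.ncard_coe_finset]
  congr 1
  ext t
  simp

theorem mistakes_blockPredictor {k : ℕ} (hk : 0 < k) (n : ℕ) {T : ℕ}
    (hT : T = (n + 1) * (2 ^ k - 1)) (β : ℕ → Bool) :
    (blockPredictor k T).mistakes (fun t => stream k β t) = n := by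
  have hm : 0 < 2 ^ k - 1 := by
    have := Nat.one_lt_two_pow hk.ne'
    omega
  have hlt : ∀ b < n, (2 ^ k - 1) * (b + 1) < T := fun b hb => by
    rw [hT, mul_comm]
    exact Nat.mul_lt_mul_of_pos_right (by omega) hm
  rw [Predictor.mistakes_eq_ncard]
  refine Set.ncard_eq_of_bijective (fun b hb => ⟨(2 ^ k - 1) * (b + 1), hlt b hb⟩) ?_ ?_ ?_
  · rintro t ⟨h0, h1⟩
    rw [blockPredictor_stream k β _ t.2.le] at h1
    have hdvd : 2 ^ k - 1 ∣ (t : ℕ) := by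
      by_contra hd
      refine h1 (if_pos (Or.inr ⟨h0, ?_⟩))
      obtain ⟨s, hs⟩ := Nat.exists_eq_add_of_le' h0
      rw [hs] at hd ⊢
      rw [Nat.succ_div_of_not_dvd hd, Nat.add_sub_cancel]
    obtain ⟨c, hc⟩ := hdvd
    have hc0 : 0 < c := Nat.pos_of_ne_zero fun h => by simp [h] at hc; omega
    have hcn : c < n + 1 := by
      have := t.2
      conv_rhs at this => rw [hT]
      rw [hc, mul_comm] at this
      exact Nat.lt_of_mul_lt_mul_right this
    refine ⟨c - 1, by omega, Fin.ext ?_⟩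
    simp only [Nat.sub_add_cancel hc0, hc]
  · intro b hb
    have h0 : 0 < (2 ^ k - 1) * (b + 1) := by positivity
    have h1 : ((2 ^ k - 1) * (b + 1) - 1) / (2 ^ k - 1) < b + 1 :=
      Nat.div_lt_of_lt_mul (by omega)
    refine ⟨h0, ?_⟩
    rw [blockPredictor_stream k β _ (hlt b hb).le, if_neg]
    · simp [stream]
    · simp only [Nat.mul_div_cancel_left _ hm]
      omega
  · intro b c _ _ h
    have := Nat.eq_of_mul_eq_mul_left hm (Fin.mk.inj h)
    omega

/-! ### The learner -/

theorem OnlineLearner.play_congr {Ω : Type*} [MeasurableSpace Ω] {X : Type*} {T : ℕ}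
    (A : OnlineLearner Ω X T) (P : Predictor X T) {x x' : Fin T → X} {y y' : Fin T → Bool}
    {t : Fin T} (hx : ∀ s ≤ t, x s = x' s) (hy : ∀ s < t, y s = y' s) (ω : Ω) :
    A.play P x y ω t = A.play P x' y' ω t := by
  have h1 : prefixOf (fun s => (x s, y s)) t = prefixOf (fun s => (x' s, y' s)) t :=
    prefixOf_congr fun s hs => by rw [hx s (Fin.le_def.2 hs.le), hy s hs]
  have h2 : ((List.range (t + 1)).map fun s => P (prefixOf x (s + 1))) =
      (List.range (t + 1)).map fun s => P (prefixOf x' (s + 1)) := by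
    refine List.map_congr_left fun s hs => ?_
    rw [List.mem_range] at hs
    rw [prefixOf_congr (x := x) (x' := x') fun i hi => hx i (Fin.le_def.2 (by omega))]
  rw [OnlineLearner.play, OnlineLearner.play, h1, h2, hx t le_rfl]

theorem OnlineLearner.measurable_play {Ω : Type*} [MeasurableSpace Ω] {X : Type*} {T : ℕ}
    (A : OnlineLearner Ω X T) (P : Predictor X T) (x : Fin T → X) (y : Fin T → Bool)
    (t : Fin T) : Measurable fun ω => A.play P x y ω t :=
  A.measurable_predict _ _ _

theorem OnlineLearner.expectedMistakes_eq_sum {Ω : Type*} [MeasurableSpace Ω] {X : Type*} {T : ℕ}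
    (μ : Measure Ω) [IsProbabilityMeasure μ] (A : OnlineLearner Ω X T) (P : Predictor X T)
    (x : Fin T → X) (y : Fin T → Bool) :
    A.expectedMistakes μ P x y = ∑ t, μ.real {ω | A.play P x y ω t ≠ y t} := by
  have hm : ∀ t, MeasurableSet {ω | A.play P x y ω t ≠ y t} := fun t =>
    (A.measurable_play P x y t) (measurableSet_singleton (y t)).compl
  have hi : ∀ t, (fun ω => if A.play P x y ω t ≠ y t then (1 : ℝ) else 0) =
      {ω | A.play P x y ω t ≠ y t}.indicator 1 := by
    intro t
    ext ω
    simp [Set.indicator_apply]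
  rw [OnlineLearner.expectedMistakes, integral_finsetSum]
  · refine Finset.sum_congr rfl fun t _ => ?_
    rw [hi, integral_indicator_one (hm t)]
  · intro t _
    rw [hi]
    exact (integrable_const (1 : ℝ)).indicator (hm t)

/-- Bits can be chosen one after the other: if `R d β` depends on the first `d + 1` bits only, and
always holds for one of the two values of bit `d`, then some sequence satisfies `R d` for
all `d < N`. -/
theorem exists_bits (N : ℕ) (R : ℕ → (ℕ → Bool) → Prop)
    (hcongr : ∀ d < N, ∀ β γ : ℕ → Bool, (∀ i ≤ d, β i = γ i) → R d β → R d γ)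
    (hstep : ∀ d < N, ∀ β : ℕ → Bool, ∃ b, R d (Function.update β d b)) :
    ∃ β, ∀ d < N, R d β := by
  suffices h : ∀ D ≤ N, ∃ β, ∀ d < D, R d β from h N le_rfl
  intro D
  induction D with
  | zero => exact fun _ => ⟨fun _ => false, fun d hd => by omega⟩
  | succ D ih =>
    intro hD
    obtain ⟨β, hβ⟩ := ih (by omega)
    obtain ⟨b, hb⟩ := hstep D hD β
    refine ⟨Function.update β D b, fun d hd => ?_⟩
    rcases Nat.lt_succ_iff_lt_or_eq.mp hd with hd | rfl
    · refine hcongr d (by omega) β _ (fun i hi => ?_) (hβ d hd)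
      rw [Function.update_of_ne (by omega)]
    · exact hb

/-- A path on which the learner errs with probability at least `1 / 2` at each of the first `N`
nodes (as far as they are presented within `T` rounds). -/
theorem exists_path_half_le {k T : ℕ} (hk : 0 < k) (N : ℕ)
    {Ω : Type*} [MeasurableSpace Ω] (μ : Measure Ω) [IsProbabilityMeasure μ]
    (A : OnlineLearner Ω ThresholdDomain T) (P : Predictor ThresholdDomain T) :
    ∃ β : ℕ → Bool, ∀ d < N, ∀ t : Fin T, (t : ℕ) = pathTime k β d →
      1 / 2 ≤ μ.real {ω | A.play P (fun s => stream k β s) (fun s => label k β s) ω t ≠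
        label k β t} := by
  have hplay : ∀ d, ∀ β γ : ℕ → Bool, (∀ i < d, β i = γ i) → ∀ t : Fin T,
      (t : ℕ) = pathTime k β d → ∀ ω,
      A.play P (fun s => stream k β s) (fun s => label k β s) ω t =
        A.play P (fun s => stream k γ s) (fun s => label k γ s) ω t := by
    intro d β γ h t ht ω
    exact A.play_congr P (fun s hs => stream_congr hk h (ht ▸ hs))
      (fun s hs => label_congr hk h (ht ▸ hs)) ω
  refine exists_bits _ _ ?_ ?_
  · intro d _ β γ h hβ t ht
    have ht' : (t : ℕ) = pathTime k β d := by
      rw [ht, pathTime_congr k fun i hi => h i (le_of_lt hi)]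
    have := hβ t ht'
    simp only [hplay d β γ (fun i hi => h i (le_of_lt hi)) t ht'] at this
    rwa [ht', label_pathTime hk, h d le_rfl, ← label_pathTime hk γ d, ← ht] at this
  · intro d hd β
    by_contra! hcon
    obtain ⟨t₀, h₀, hlt₀⟩ := hcon false
    obtain ⟨t₁, h₁, hlt₁⟩ := hcon true
    have hagree : ∀ b, ∀ i < d, Function.update β d b i = β i := fun b i hi =>
      Function.update_of_ne (by omega) _ _
    have hlab : ∀ (b : Bool) (t : Fin T), (t : ℕ) = pathTime k (Function.update β d b) d →
        label k (Function.update β d b) t = b := fun b t ht => by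
      rw [ht, label_pathTime hk, Function.update_self]
    have htt : t₁ = t₀ := Fin.ext <| by
      rw [h₀, h₁, pathTime_congr k (hagree false), pathTime_congr k (hagree true)]
    subst htt
    simp only [hplay d _ _ (hagree _) _ h₀, hlab _ _ h₀] at hlt₀
    simp only [hplay d _ _ (hagree _) _ h₁, hlab _ _ h₁] at hlt₁
    have hm : MeasurableSet {ω | A.play P (fun s => stream k β s) (fun s => label k β s) ω t₁ ≠
        true} := (A.measurable_play P _ _ t₁) (measurableSet_singleton true).compl
    have hc := probReal_compl_eq_one_sub (μ := μ) hm
    have hset : {ω | A.play P (fun s => stream k β s) (fun s => label k β s) ω t₁ ≠ true}ᶜ =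
        {ω | A.play P (fun s => stream k β s) (fun s => label k β s) ω t₁ ≠ false} := by
      ext ω
      simp
    rw [hset] at hc
    linarith

theorem le_expectedMistakes_of_path {k n T : ℕ} (hk : 0 < k) (hT : T = (n + 1) * (2 ^ k - 1))
    {Ω : Type*} [MeasurableSpace Ω] (μ : Measure Ω) [IsProbabilityMeasure μ]
    (A : OnlineLearner Ω ThresholdDomain T) (P : Predictor ThresholdDomain T) (β : ℕ → Bool)
    (hβ : ∀ d < (n + 1) * k, ∀ t : Fin T, (t : ℕ) = pathTime k β d →
      1 / 2 ≤ μ.real {ω | A.play P (fun s => stream k β s) (fun s => label k β s) ω t ≠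
        label k β t}) :
    ((n : ℝ) + 1) * k / 2 ≤
      A.expectedMistakes μ P (fun t => stream k β t) (fun t => label k β t) := by
  rw [OnlineLearner.expectedMistakes_eq_sum]
  let τ : Fin ((n + 1) * k) ↪ Fin T :=
    ⟨fun d => ⟨pathTime k β d, hT ▸ pathTime_lt hk β d.2⟩, fun d e h => by
      have := congrArg (fun t : Fin T => depth k t) h
      simp only [depth_pathTime hk] at this
      exact Fin.ext this⟩
  calc ((n : ℝ) + 1) * k / 2 = ∑ _d : Fin ((n + 1) * k), (1 / 2 : ℝ) := by
        simp
        ring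
    _ ≤ ∑ d, μ.real {ω | A.play P (fun s => stream k β s) (fun s => label k β s) ω (τ d) ≠
          label k β (τ d)} := Finset.sum_le_sum fun d _ => hβ d d.2 (τ d) rfl
    _ = ∑ t ∈ Finset.univ.map τ, μ.real {ω | A.play P (fun s => stream k β s)
          (fun s => label k β s) ω t ≠ label k β t} := by rw [Finset.sum_map]
    _ ≤ _ := Finset.sum_le_sum_of_subset_of_nonneg (Finset.subset_univ _)
        fun _ _ _ => measureReal_nonneg

theorem theorem2 (T n : ℕ) (hT : 0 < T) (hdvd : n + 1 ∣ T)
    (hpow : ∃ k : ℕ, T / (n + 1) + 1 = 2 ^ k) :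
    ∃ P : Predictor ThresholdDomain T, P.IsConsistent ∧ P.IsLazy ∧
      ∀ (Ω : Type*) [MeasurableSpace Ω] (μ : Measure Ω) [IsProbabilityMeasure μ]
        (A : OnlineLearner Ω ThresholdDomain T),
        ∃ (x : Fin T → ThresholdDomain) (y : Fin T → Bool),
          Realizable thresholdClass x y ∧
          P.mistakes x = n ∧
          ((n : ℝ) + 1) / 2 * Real.logb 2 ((T : ℝ) / ((n : ℝ) + 1))
            ≤ A.expectedMistakes μ P x y := by
  obtain ⟨k, hk⟩ := hpow
  obtain ⟨m, rfl⟩ := hdvd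
  rw [Nat.mul_div_cancel_left m n.succ_pos] at hk
  have hm : 0 < m := Nat.pos_of_mul_pos_left hT
  have hk0 : 0 < k := Nat.pos_of_ne_zero fun h => by simp [h] at hk; omega
  have hTm : (n + 1) * m = (n + 1) * (2 ^ k - 1) := by rw [← hk, Nat.add_sub_cancel]
  refine ⟨blockPredictor k _, revisingPredictor_isConsistent _ _, revisingPredictor_isLazy _ _, ?_⟩
  intro Ω _ μ _ A
  obtain ⟨β, hβ⟩ := exists_path_half_le hk0 ((n + 1) * k) μ A (blockPredictor k _)
  refine ⟨fun t => stream k β t, fun t => label k β t, ?_,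
    mistakes_blockPredictor hk0 n hTm β, ?_⟩
  · exact ⟨_, ⟨pathEnd β ((n + 1) * k), rfl⟩, fun t =>
      threshold_stream k β (depth_lt hk0 (hTm ▸ t.2))⟩
  · refine le_trans ?_ (le_expectedMistakes_of_path hk0 hTm μ A _ β hβ)
    have hlog : Real.logb 2 ((((n + 1) * m : ℕ) : ℝ) / ((n : ℝ) + 1)) ≤ k := by
      have hn : (n : ℝ) + 1 ≠ 0 := by positivity
      have hdiv : (((n + 1) * m : ℕ) : ℝ) / ((n : ℝ) + 1) = m := by
        push_cast
        field_simp
      have hmk : (m : ℝ) ≤ 2 ^ k := by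
        have : m ≤ 2 ^ k := by omega
        exact_mod_cast this
      rw [hdiv, Real.logb_le_iff_le_rpow one_lt_two (by exact_mod_cast hm), Real.rpow_natCast]
      exact hmk
    calc ((n : ℝ) + 1) / 2 * Real.logb 2 ((((n + 1) * m : ℕ) : ℝ) / ((n : ℝ) + 1))
        ≤ ((n : ℝ) + 1) / 2 * k := by gcongr
      _ = ((n : ℝ) + 1) * k / 2 := by ring
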